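/- **Proposition.** Let $X=(X_i)_{i\ge 1}$ be an exchangeable sequence of real random variables on a probability space, let $\chi$ be its distribution (a Borel probability measure on $\mathbb R^\omega$), let $\nu$ be its directing random measure, i.e. a random Borel probability measure on $\mathbb R$ with $\Pr[X\in\cdot\mid\nu]=\nu^\infty$ almost surely, and let $\mu$ be the distribution of $\nu$ (the de Finetti measure, a probability measure on the space $\mathcal M_1(\mathbb R)$ of Borel probability measures on $\mathbb R$). Then $\chi$ is uniformly computable in $\mu$: there is a single program with an oracle which, for all such $X$, $\nu$, $\chi$ and $\mu$, when it is given any enumeration of the representation of $\mu$ as its oracle, enumerates the representation of $\chi$. Here a measure $\eta$ on a space with an enumerated countable subbasis is represented by the set of all (codes of) pairs $(B,q)$, where $q\in\mathbb Q$, $B$ is a finite union of finite intersections of subbasic sets, and $\eta(B)>q$. The subbases are as follows: * on $\mathbb R$, the open intervals with rational endpoints; * on $\mathbb R^\omega$, the cylinders $\tau(1)\times\dots\times\tau(k)\times\mathbb R\times\mathbb R\times\cdots$, where $\tau(1),\dots,\tau(k)$ are open intervals with rational endpoints; * on $\mathcal M_1(\mathbb R)$, the sets $\{\gamma : \gamma(\sigma)>q\}$,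 where $q\in\mathbb Q$ and $\sigma$ is a finite union of finite intersections of open intervals with rational endpoints. An enumeration of a set $A\subseteq\mathbb N$ is a function $f:\mathbb N\to\mathbb N$ such that $n\in A$ if and only if $f(k)=n+1$ for some $k$; a program enumerates $A$ if $A$ is the set of inputs on which it halts. -/

import Mathlib

open MeasureTheory ProbabilityTheory

namespace ComputableDeFinetti

/-! ### Programs with an oracle -/

/-- Programs for partial recursive functions with an oracle. The constructors are those of
Mathlib's `Nat.RecursiveIn`; having them as data makes it possible to say that one and the same
program works for all oracles. -/
inductive OracleCode : Type
  | zero : OracleCode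
  | succ : OracleCode
  | left : OracleCode
  | right : OracleCode
  | oracle : OracleCode
  | pair : OracleCode → OracleCode → OracleCode
  | comp : OracleCode → OracleCode → OracleCode
  | prec : OracleCode → OracleCode → OracleCode
  | rfind : OracleCode → OracleCode

/-- The partial function computed by a program when it is run with the oracle `f`. -/
def OracleCode.eval (f : ℕ → ℕ) : OracleCode → ℕ →. ℕ
  | .zero => fun _ => Part.some 0
  | .succ => fun n => Part.some (n + 1)
  | .left => fun n => Part.some n.unpair.1
  | .right => fun n => Part.some n.unpair.2
  | .oracle => fun n => Part.some (f n)
  | .pair c d => fun n => Nat.pair <$> c.eval f n <*> d.eval f n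
  | .comp c d => fun n => d.eval f n >>= c.eval f
  | .prec c d => fun p =>
      let (a, n) := Nat.unpair p
      n.rec (c.eval f a) fun y IH => do
        let i ← IH
        d.eval f (Nat.pair a (Nat.pair y i))
  | .rfind c => fun a => Nat.rfind fun n => (fun m => decide (m = 0)) <$> c.eval f (Nat.pair a n)

/-- Running the programs with the oracle `f` gives exactly the functions that are partial
recursive in `f` in Mathlib's sense. -/
theorem OracleCode.exists_eval_iff (f : ℕ → ℕ) (g : ℕ →. ℕ) :
    (∃ c : OracleCode, c.eval f = g) ↔ Nat.RecursiveIn {(f : ℕ →. ℕ)} g := by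
  constructor
  · rintro ⟨c, rfl⟩
    induction c with
    | zero => exact .zero
    | succ => exact .succ
    | left => exact .left
    | right => exact .right
    | oracle => exact .oracle _ rfl
    | pair c d hc hd => exact .pair hc hd
    | comp c d hc hd => exact .comp hc hd
    | prec c d hc hd => exact .prec hc hd
    | rfind c hc => exact .rfind hc
  · intro h
    induction h with
    | zero => exact ⟨.zero, rfl⟩
    | succ => exact ⟨.succ, rfl⟩
    | left => exact ⟨.left, rfl⟩
    | right => exact ⟨.right, rfl⟩
    | oracle g hg => exact ⟨.oracle, hg.symm⟩
    | pair _ _ hc hd =>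
        obtain ⟨c, rfl⟩ := hc
        obtain ⟨d, rfl⟩ := hd
        exact ⟨.pair c d, rfl⟩
    | comp _ _ hc hd =>
        obtain ⟨c, rfl⟩ := hc
        obtain ⟨d, rfl⟩ := hd
        exact ⟨.comp c d, rfl⟩
    | prec _ _ hc hd =>
        obtain ⟨c, rfl⟩ := hc
        obtain ⟨d, rfl⟩ := hd
        exact ⟨.prec c d, rfl⟩
    | rfind _ hc =>
        obtain ⟨c, rfl⟩ := hc
        exact ⟨.rfind c, rfl⟩

/-- `f` enumerates `A ⊆ ℕ`: the value `n + 1` announces the element `n`, and the value `0`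
announces nothing. -/
def Enumerates (f : ℕ → ℕ) (A : Set ℕ) : Prop :=
  ∀ n, n ∈ A ↔ ∃ k, f k = n + 1

/-- With any enumeration of `B` as its oracle, the program `c` enumerates `A` (as the set of
inputs on which it halts). A representation is positive information: an object is computable when
its representation is a c.e. set, so it is an enumeration of it that is given as the oracle. -/
def OracleCode.ComputesFrom (c : OracleCode) (A B : Set ℕ) : Prop :=
  ∀ f : ℕ → ℕ, Enumerates f B → ∀ n, n ∈ A ↔ (c.eval f n).Dom

/-! ### Computable topological spaces and measures on them -/

/-- Names of rational numbers. -/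
abbrev RatCode : Type := ℕ × ℕ × ℕ

/-- The canonical enumeration of the rationals, `(a, b, c) ↦ (a - b) / (c + 1)`. -/
def ratOf (p : RatCode) : ℚ := ((p.1 : ℚ) - p.2.1) / (p.2.2 + 1)

/-- The representation of a point `x` of a space with the enumerated subbasis `s`: the indices of
the subbasic sets that contain `x`. -/
def pointRep {ι S : Type*} [Encodable ι] (s : ι → Set S) (x : S) : Set ℕ :=
  {n | ∃ i, Encodable.encode i = n ∧ x ∈ s i}

/-- The finite unions of finite intersections of subbasic sets. -/
def latticeSet {ι S : Type*} (s : ι → Set S) (L : List (List ι)) : Set S :=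
  {x | ∃ l ∈ L, ∀ i ∈ l, x ∈ s i}

/-- The subbasis `{γ | γ σ > q}` of the space of Borel probability measures on `S`, where `σ` is a
finite union of finite intersections of subbasic sets of `S`, and `q` is rational. The
representation of a measure is its representation as a point with respect to this subbasis, that
is, the set of all `(σ, q)` with `γ σ > q`. -/
def measureSubbasis {ι S : Type*} [MeasurableSpace S] (s : ι → Set S) :
    List (List ι) × RatCode → Set (ProbabilityMeasure S) :=
  fun p => {γ | (ratOf p.2 : ℝ) < (γ : Measure S).real (latticeSet s p.1)}

/-- The open intervals with rational endpoints. -/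
def ratInterval (p : RatCode × RatCode) : Set ℝ :=
  Set.Ioo (ratOf p.1 : ℝ) (ratOf p.2 : ℝ)

/-- The cylinders `τ(0) × ⋯ × τ(k - 1) × ℝ × ℝ × ⋯` over the open intervals with rational
endpoints. -/
def ratCylinder (τ : List (RatCode × RatCode)) : Set (ℕ → ℝ) :=
  {x | ∀ (i : ℕ) (hi : i < τ.length), x i ∈ ratInterval τ[i]}

/-- The representation of a distribution on real sequences. -/
def seqLawRep (χ : ProbabilityMeasure (ℕ → ℝ)) : Set ℕ :=
  pointRep (measureSubbasis ratCylinder) χ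

/-- The representation of a distribution on Borel probability measures on the line. -/
def measureLawRep (μ : ProbabilityMeasure (ProbabilityMeasure ℝ)) : Set ℕ :=
  pointRep (measureSubbasis (measureSubbasis ratInterval)) μ

/-! ### Exchangeable sequences -/

/-- For any distinct indices `k 0, …, k (n - 1)`, the vector `(X (k 0), …, X (k (n - 1)))` is equal
in distribution to `(X 0, …, X (n - 1))`. -/
def Exchangeable {Ω : Type*} [MeasurableSpace Ω] (P : Measure Ω) (X : ℕ → Ω → ℝ) : Prop :=
  ∀ (n : ℕ) (k : Fin n → ℕ), Function.Injective k →
    P.map (fun ω (i : Fin n) => X (k i) ω) = P.map (fun ω (i : Fin n) => X i ω)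

/-- `ν` is a directing random measure of `X`: a random probability measure on the line with
`P[X ∈ · | ν] = ν^∞` almost surely. -/
structure IsDirectingRandomMeasure {Ω : Type*} [MeasurableSpace Ω] (P : Measure Ω)
    (X : ℕ → Ω → ℝ) (ν : Ω → ProbabilityMeasure ℝ) : Prop where
  measurable : Measurable ν
  condExp_eq : ∀ B : Set (ℕ → ℝ), MeasurableSet B →
    P⟦(fun ω i => X i ω) ⁻¹' B | MeasurableSpace.comap ν inferInstance⟧ =ᵐ[P]
      fun ω => (Measure.infinitePi fun _ : ℕ => (ν ω : Measure ℝ)).real B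

end ComputableDeFinetti

namespace ComputableDeFinetti

/-! For boxes `s (j 0) × ⋯ × s (j (N - 1)) × ℝ × ⋯` that are pairwise disjoint, taking expectations
in `P[X ∈ · | ν] = ν^∞` shows that the union over `j ∈ J` has `χ`-mass `E ∑ j, ∏ i, ν (s (j i))`. No
inclusion-exclusion occurs, so lower bounds suffice, and these are the only information that an
enumeration of the representation of `μ` gives.

The integral is bounded from below by counting. Up to rounding, `K * ν (s a)` is the number of
levels `n ≥ 1` with `n < K * ν (s a)`. Hence the sum of products is a count of pairs `(j, n)`, its
expectation is a sum of `μ`-masses of finite intersections of subbasic sets, and each mass is in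
turn a count of levels `t`. The number of true statements `t / K < μ (⋂ i, {γ | γ (s (j i)) > n i /
K})`, divided by `K ^ (N + 1)`, never exceeds the mass of the union (`card_levels_le`) and falls
short of it by at most `J.card * (N + 1) / K` (`le_card_levels`).

An open set contains finitely many disjoint boxes that exhaust its mass up to `ε` (`exists_cells`,
`exists_boxes`). Therefore `χ B > q` if and only if there is a finite certificate, a primitive
recursive object all of whose statements belong to the representation of `μ`
(`ratOf_lt_of_certifies`, `exists_certifies`). One program searches for certificates in the oracle
(`exists_computesFrom`). -/

/-! ### Oracle programs and unbounded search -/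

theorem OracleCode.eval_comp_of_eq {f : ℕ → ℕ} {c d : OracleCode} {n m : ℕ}
    (h : d.eval f n = Part.some m) : (comp c d).eval f n = c.eval f m := by
  change (d.eval f n).bind (c.eval f) = _
  rw [h]
  exact Part.bind_some _ _

theorem OracleCode.eval_pair_of_eq {f : ℕ → ℕ} {c d : OracleCode} {n a b : ℕ}
    (hc : c.eval f n = Part.some a) (hd : d.eval f n = Part.some b) :
    (pair c d).eval f n = Part.some (Nat.pair a b) := by
  change (Nat.pair <$> c.eval f n) <*> d.eval f n = _
  rw [hc, hd]
  simp [Seq.seq]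

theorem OracleCode.eval_prec_zero {f : ℕ → ℕ} {c d : OracleCode} {a : ℕ} :
    (prec c d).eval f (Nat.pair a 0) = c.eval f a := by
  simp [eval]

theorem OracleCode.eval_prec_succ {f : ℕ → ℕ} {c d : OracleCode} {a y i : ℕ}
    (h : (prec c d).eval f (Nat.pair a y) = Part.some i) :
    (prec c d).eval f (Nat.pair a (y + 1)) = d.eval f (Nat.pair a (Nat.pair y i)) := by
  have : (prec c d).eval f (Nat.pair a (y + 1)) = ((prec c d).eval f (Nat.pair a y)).bind
      fun i => d.eval f (Nat.pair a (Nat.pair y i)) := by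
    simp [eval]
  rw [this, h]
  exact Part.bind_some _ _

/-- As all the tested values are defined, the search cannot get stuck before a zero. -/
theorem OracleCode.eval_rfind_dom {f : ℕ → ℕ} {c : OracleCode} {n : ℕ} {g : ℕ → ℕ}
    (h : ∀ m, c.eval f (Nat.pair n m) = Part.some (g m)) :
    ((rfind c).eval f n).Dom ↔ ∃ m, g m = 0 := by
  have key : ∀ m, ((fun m => decide (m = 0)) <$> c.eval f (Nat.pair n m) : Part Bool) =
      Part.some (decide (g m = 0)) := fun m => by rw [h]; simp
  change (Nat.rfind fun m => ((fun m => decide (m = 0)) <$> c.eval f (Nat.pair n m) :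
    Part Bool)).Dom ↔ _
  refine Nat.rfind_dom.trans ⟨?_, ?_⟩
  · rintro ⟨m, hm, -⟩
    rw [key] at hm
    exact ⟨m, by simpa using hm⟩
  · rintro ⟨m, hm⟩
    refine ⟨m, ?_, fun {k} _ => ?_⟩
    · rw [key]
      simpa using hm
    · rw [key]
      trivial

/-- The program never consults its oracle, so one program serves for every `f`. -/
theorem OracleCode.exists_eval_eq_of_primrec {g : ℕ → ℕ} (hg : Nat.Primrec g) :
    ∃ c : OracleCode, ∀ (f : ℕ → ℕ) (n : ℕ), c.eval f n = Part.some (g n) := by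
  induction hg with
  | zero => exact ⟨.zero, fun _ _ => rfl⟩
  | succ => exact ⟨.succ, fun _ _ => rfl⟩
  | left => exact ⟨.left, fun _ _ => rfl⟩
  | right => exact ⟨.right, fun _ _ => rfl⟩
  | pair _ _ hc hd =>
    obtain ⟨c, hc⟩ := hc
    obtain ⟨d, hd⟩ := hd
    exact ⟨.pair c d, fun f n => eval_pair_of_eq (hc f n) (hd f n)⟩
  | comp _ _ hc hd =>
    obtain ⟨c, hc⟩ := hc
    obtain ⟨d, hd⟩ := hd
    exact ⟨.comp c d, fun f n => (eval_comp_of_eq (hd f n)).trans (hc f _)⟩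
  | prec _ _ hc hd =>
    obtain ⟨c, hc⟩ := hc
    obtain ⟨d, hd⟩ := hd
    refine ⟨.prec c d, fun f n => ?_⟩
    rw [← Nat.pair_unpair n]
    simp only [Nat.unpaired, Nat.unpair_pair]
    induction n.unpair.2 with
    | zero => exact eval_prec_zero.trans (hc f _)
    | succ y ih => exact (eval_prec_succ ih).trans (hd f _)

/-- The first `k` values of `f`, the last one first. -/
def oraclePrefix (f : ℕ → ℕ) : ℕ → List ℕ
  | 0 => []
  | k + 1 => f k :: oraclePrefix f k

theorem mem_oraclePrefix {f : ℕ → ℕ} {m : ℕ} :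
    ∀ {k : ℕ}, m ∈ oraclePrefix f k ↔ ∃ j < k, f j = m
  | 0 => by simp [oraclePrefix]
  | k + 1 => by
    simp only [oraclePrefix, List.mem_cons, mem_oraclePrefix, Nat.lt_succ_iff_lt_or_eq]
    constructor
    · rintro (rfl | ⟨j, hj, rfl⟩)
      exacts [⟨k, .inr rfl, rfl⟩, ⟨j, .inl hj, rfl⟩]
    · rintro ⟨j, hj | rfl, rfl⟩
      exacts [.inr ⟨j, hj, rfl⟩, .inl rfl]

theorem OracleCode.exists_eval_oraclePrefix :
    ∃ c : OracleCode, ∀ (f : ℕ → ℕ) (k : ℕ),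
      c.eval f k = Part.some (Encodable.encode (oraclePrefix f k)) := by
  -- The code of `a :: l` is the successor of the pair of the codes of `a` and `l`, and that of `[]`
  -- is `0`. The recursion runs with the dummy parameter `0`; `.pair .left .right` is the identity.
  refine ⟨.comp (.prec .zero (.comp .succ (.pair (.comp .oracle (.comp .left .right))
    (.comp .right .right)))) (.pair .zero (.pair .left .right)), fun f k => ?_⟩
  rw [eval_comp_of_eq (eval_pair_of_eq (a := 0) (b := k) rfl
    ((eval_pair_of_eq rfl rfl).trans (by rw [Nat.pair_unpair])))]
  induction k with
  | zero => exact eval_prec_zero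
  | succ y ih =>
    rw [eval_prec_succ ih]
    refine (eval_comp_of_eq (eval_pair_of_eq (a := f y)
      (b := Encodable.encode (oraclePrefix f y)) ?_ ?_)).trans rfl
    · exact (eval_comp_of_eq ((eval_comp_of_eq rfl).trans rfl)).trans (by simp [eval])
    · exact (eval_comp_of_eq rfl).trans (by simp [eval])

/-- Search for a witness and a piece of the oracle that satisfy a primitive recursive condition. -/
theorem OracleCode.exists_dom_iff {R : ℕ × ℕ × List ℕ → Prop} (hR : PrimrecPred R) :
    ∃ c : OracleCode, ∀ (f : ℕ → ℕ) (n : ℕ),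
      (c.eval f n).Dom ↔ ∃ s k, R (n, s, oraclePrefix f k) := by
  classical
  let G : ℕ × ℕ × List ℕ → ℕ := fun x => if R x then 0 else 1
  have hG : Primrec G := Primrec.ite hR (Primrec.const 0) (Primrec.const 1)
  -- The default `1` means failure, as it does for `G`.
  let g : ℕ → ℕ := fun m =>
    ((Encodable.decode (α := ℕ × ℕ × List ℕ) m).map G).getD 1
  have hg : Primrec g :=
    Primrec.option_getD.comp (Primrec.option_map Primrec.decode (hG.comp Primrec.snd).to₂)
      (Primrec.const 1)
  obtain ⟨cg, hcg⟩ := exists_eval_eq_of_primrec (Primrec.nat_iff.1 hg)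
  obtain ⟨cp, hcp⟩ := exists_eval_oraclePrefix
  -- The number that is searched for codes the pair of the witness `s` and the length `k` of the
  -- piece of the oracle.
  refine ⟨.rfind (.comp cg (.pair .left (.pair (.comp .left .right)
    (.comp cp (.comp .right .right))))), fun f n => ?_⟩
  have key : ∀ m : ℕ, eval f (.comp cg (.pair .left (.pair (.comp .left .right)
      (.comp cp (.comp .right .right))))) (Nat.pair n m) =
      Part.some (G (n, m.unpair.1, oraclePrefix f m.unpair.2)) := by
    intro m
    refine (eval_comp_of_eq (m := Encodable.encode (n, m.unpair.1, oraclePrefix f m.unpair.2))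
      (eval_pair_of_eq (by simp [eval]) (eval_pair_of_eq ?_ ?_))).trans ?_
    · exact (eval_comp_of_eq rfl).trans (by simp [eval])
    · exact (eval_comp_of_eq (eval_comp_of_eq rfl)).trans ((hcp f _).trans (by simp))
    · rw [hcg]
      simp [g]
  rw [eval_rfind_dom key]
  constructor
  · rintro ⟨m, hm⟩
    exact ⟨_, _, by simpa [G] using hm⟩
  · rintro ⟨s, k, h⟩
    exact ⟨Nat.pair s k, by simpa [G] using h⟩

/-- A primitive recursive condition on finitely many elements of a set leads to a program that
works with every enumeration of the set. -/
theorem OracleCode.exists_computesFrom {ι κ : Type*} [Primcodable ι] [Primcodable κ]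
    {V : ι → κ → Prop} (hV : PrimrecRel V) {w : κ → List ℕ} (hw : Primrec w) :
    ∃ c : OracleCode, ∀ A B : Set ℕ,
      (∀ n, n ∈ A ↔ ∃ i, Encodable.encode i = n ∧ ∃ k, V i k ∧ ∀ u ∈ w k, u ∈ B) →
      c.ComputesFrom A B := by
  let T : (ℕ × ℕ × List ℕ) → ι → κ → Prop := fun x i k =>
    (Encodable.encode i = x.1 ∧ V i k) ∧ ∀ u ∈ w k, ∃ v ∈ x.2.2, v = u + 1
  have hT : PrimrecPred fun y : κ × ι × ℕ × ℕ × List ℕ => T y.2.2 y.2.1 y.1 := by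
    refine ((Primrec.eq.comp (Primrec.encode.comp (Primrec.fst.comp Primrec.snd))
      (Primrec.fst.comp (Primrec.snd.comp Primrec.snd))).and
      (hV.comp (Primrec.fst.comp Primrec.snd) Primrec.fst)).and ?_
    have h1 : PrimrecRel fun (v u : ℕ) => v = u + 1 :=
      Primrec.eq.comp Primrec.fst (Primrec.succ.comp Primrec.snd)
    have h2 : PrimrecRel fun (u : ℕ) (l : List ℕ) => ∃ v ∈ l, v = u + 1 :=
      h1.exists_mem_list.comp Primrec.snd Primrec.fst
    exact h2.forall_mem_list.comp (hw.comp Primrec.fst)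
      (Primrec.snd.comp (Primrec.snd.comp (Primrec.snd.comp Primrec.snd)))
  have hT1 : PrimrecRel fun (k : κ) (y : ι × ℕ × ℕ × List ℕ) => T y.2 y.1 k := hT
  -- Seen as a list with at most one element, the decoded value turns the quantifier into a bounded
  -- one.
  have hT2 : PrimrecRel fun (i : ι) (x : ℕ × ℕ × List ℕ) =>
      ∃ k ∈ (Encodable.decode (α := κ) x.2.1).toList, T x i k :=
    hT1.exists_mem_list.comp (Primrec.optionToList.comp (Primrec.decode.comp
      (Primrec.fst.comp (Primrec.snd.comp Primrec.snd)))) Primrec.id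
  have hT3 : PrimrecPred fun x : ℕ × ℕ × List ℕ =>
      ∃ i ∈ (Encodable.decode (α := ι) x.1).toList,
        ∃ k ∈ (Encodable.decode (α := κ) x.2.1).toList, T x i k :=
    hT2.exists_mem_list.comp (Primrec.optionToList.comp (Primrec.decode.comp Primrec.fst))
      Primrec.id
  obtain ⟨c, hc⟩ := exists_dom_iff hT3
  refine ⟨c, fun A B hAB f hf n => ?_⟩
  rw [hc, hAB]
  constructor
  · rintro ⟨i, rfl, k, hV, hk⟩
    -- Finitely many elements of `B` are all announced within a common initial piece of `f`.
    have hbd : ∀ l : List ℕ, (∀ u ∈ l, u ∈ B) → ∃ K, ∀ u ∈ l, ∃ j < K, f j = u + 1 := by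
      intro l hl
      induction l with
      | nil => exact ⟨0, by simp⟩
      | cons a l ih =>
        obtain ⟨K, hK⟩ := ih fun u hu => hl u (List.mem_cons_of_mem _ hu)
        obtain ⟨j, hj⟩ := (hf a).1 (hl a List.mem_cons_self)
        refine ⟨K + j + 1, fun u hu => ?_⟩
        rcases List.mem_cons.1 hu with rfl | hu
        · exact ⟨j, by omega, hj⟩
        · obtain ⟨j', h, h'⟩ := hK u hu
          exact ⟨j', by omega, h'⟩
    obtain ⟨K, hK⟩ := hbd _ hk
    refine ⟨Encodable.encode k, K, i, by simp, k, by simp, ⟨rfl, hV⟩, fun u hu => ?_⟩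
    exact ⟨u + 1, mem_oraclePrefix.2 (hK u hu), rfl⟩
  · rintro ⟨s, K, i, -, k, -, ⟨hi, hV⟩, hu⟩
    refine ⟨i, hi, k, hV, fun u h => ?_⟩
    obtain ⟨v, hv, rfl⟩ := hu u h
    obtain ⟨j, -, hj⟩ := mem_oraclePrefix.1 hv
    exact (hf u).2 ⟨j, hj⟩

/-! ### Certificates and their primitive recursive verification -/

/-- The order of the rationals in terms of their names. -/
def RatLE (p q : RatCode) : Prop :=
  p.1 * (q.2.2 + 1) + q.2.1 * (p.2.2 + 1) ≤ q.1 * (p.2.2 + 1) + p.2.1 * (q.2.2 + 1)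

/-- Cross-multiplication, with the subtracted terms moved across so that only natural numbers occur.
-/
theorem ratLE_iff {p q : RatCode} : RatLE p q ↔ ratOf p ≤ ratOf q := by
  have hp : (0 : ℚ) < p.2.2 + 1 := by positivity
  have hq : (0 : ℚ) < q.2.2 + 1 := by positivity
  rw [ratOf, ratOf, div_le_div_iff₀ hp hq, RatLE, ← Nat.cast_le (α := ℚ)]
  push_cast
  constructor <;> intro h <;> linarith

/-- The open intervals with the given names are disjoint. -/
def Separated (a b : RatCode × RatCode) : Prop :=
  -- The last two cases are those of an empty interval.
  (RatLE a.2 b.1 ∨ RatLE b.2 a.1) ∨ RatLE a.2 a.1 ∨ RatLE b.2 b.1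

/-- The box with the sides `(w i).1` lies in the cylinder `τ`. -/
def Fits (τ : List (RatCode × RatCode)) (w : List ((RatCode × RatCode) × ℕ)) : Prop :=
  τ.length ≤ w.length ∧ ∀ i < τ.length,
    RatLE (τ.getD i 0).1 (w.getD i 0).1.1 ∧ RatLE (w.getD i 0).1.2 (τ.getD i 0).2

/-- A level `t` and a word of intervals with a level for each of them. -/
abbrev Item : Type := ℕ × List ((RatCode × RatCode) × ℕ)

/-- A family of disjoint intervals, a number `D` such that the levels are multiples of
`1 / (D + 1)`, a dimension, and a list of items. -/
abbrev Certificate : Type := (List (RatCode × RatCode) × ℕ × ℕ) × List Item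

/-- The name of the condition that the event `⋂ i, {γ | γ (w i).1 > (w i).2 / (D + 1)}` has a
probability greater than `t / (D + 1)`. -/
def itemName (D : ℕ) (x : Item) :
    List (List (List (List (RatCode × RatCode)) × RatCode)) × RatCode :=
  ([x.2.map fun p => ([[p.1]], (p.2, 0, D))], (x.1, 0, D))

/-- The items are distinct, their intervals come from the disjoint family, the boxes that they
span are contained in the open set, and there are more than `q * (D + 1) ^ (N + 1)` of them. -/
def Certifies (i : List (List (List (RatCode × RatCode))) × RatCode) (c : Certificate) : Prop :=
  (∀ a ∈ c.1.1, ∀ b ∈ c.1.1, a = b ∨ Separated a b) ∧ c.2.Nodup ∧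
    -- Level `0` is excluded because only the positive levels below `K * x` number at most `K * x`.
    (∀ x ∈ c.2, x.2.length = c.1.2.2 ∧ 0 < x.1 ∧ (∀ p ∈ x.2, p.1 ∈ c.1.1 ∧ 0 < p.2) ∧
      ∃ l ∈ i.1, ∀ τ ∈ l, Fits τ x.2) ∧
    -- The inequality `q < length / (D + 1) ^ (N + 1)`, cleared of denominators and of the minus
    -- sign in `q`.
    i.2.1 * (c.1.2.1 + 1) ^ (c.1.2.2 + 1) <
      c.2.length * (i.2.2.2 + 1) + i.2.2.1 * (c.1.2.1 + 1) ^ (c.1.2.2 + 1)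

section Primrec

open Primrec

theorem primrecRel_ratLE : PrimrecRel RatLE := by
  have h1 : Primrec fun x : RatCode × RatCode => x.1.2.2 + 1 :=
    succ.comp (snd.comp (snd.comp fst))
  have h2 : Primrec fun x : RatCode × RatCode => x.2.2.2 + 1 :=
    succ.comp (snd.comp (snd.comp snd))
  exact nat_le.comp
    (nat_add.comp (nat_mul.comp (fst.comp fst) h2) (nat_mul.comp (fst.comp (snd.comp snd)) h1))
    (nat_add.comp (nat_mul.comp (fst.comp snd) h1) (nat_mul.comp (fst.comp (snd.comp fst)) h2))

theorem primrecRel_separated : PrimrecRel Separated :=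
  ((primrecRel_ratLE.comp (snd.comp fst) (fst.comp snd)).or
    (primrecRel_ratLE.comp (snd.comp snd) (fst.comp fst))).or
    ((primrecRel_ratLE.comp (snd.comp fst) (fst.comp fst)).or
    (primrecRel_ratLE.comp (snd.comp snd) (fst.comp snd)))

theorem primrecRel_forall_lt {α : Type*} [Primcodable α] {R : ℕ → α → Prop} (h : PrimrecRel R) :
    PrimrecRel fun (n : ℕ) (a : α) => ∀ i < n, R i a :=
  (h.forall_mem_list.comp (list_range.comp fst) snd).of_eq (by simp)

theorem primrecRel_fits : PrimrecRel Fits := by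
  have hτ : Primrec fun x : ℕ × List (RatCode × RatCode) × List ((RatCode × RatCode) × ℕ) =>
      x.2.1.getD x.1 0 := (list_getD 0).comp (fst.comp snd) fst
  have hw : Primrec fun x : ℕ × List (RatCode × RatCode) × List ((RatCode × RatCode) × ℕ) =>
      (x.2.2.getD x.1 0).1 := fst.comp ((list_getD 0).comp (snd.comp snd) fst)
  have h : PrimrecRel fun (i : ℕ)
      (x : List (RatCode × RatCode) × List ((RatCode × RatCode) × ℕ)) =>
      RatLE (x.1.getD i 0).1 (x.2.getD i 0).1.1 ∧ RatLE (x.2.getD i 0).1.2 (x.1.getD i 0).2 :=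
    (primrecRel_ratLE.comp (fst.comp hτ) (fst.comp hw)).and
      (primrecRel_ratLE.comp (snd.comp hw) (snd.comp hτ))
  have h' := primrecRel_forall_lt h
  exact (nat_le.comp (list_length.comp fst) (list_length.comp snd)).and
    (h'.comp (list_length.comp fst) Primrec.id)

theorem primrecPred_nodup {α : Type*} [Primcodable α] :
    PrimrecPred (List.Nodup : List α → Prop) := by
  have h1 : PrimrecRel fun (j : ℕ) (x : ℕ × List α) => ¬ x.2[j]? = x.2[x.1]? :=
    (Primrec.eq.comp (list_getElem?.comp (snd.comp snd) fst)
      (list_getElem?.comp (snd.comp snd) (fst.comp snd))).not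
  have h2 : PrimrecRel fun (i : ℕ) (l : List α) => ∀ j < i, ¬ l[j]? = l[i]? := by
    have h1' := primrecRel_forall_lt h1
    exact h1'.comp fst Primrec.id
  have h2' := primrecRel_forall_lt h2
  refine (h2'.comp list_length Primrec.id).of_eq fun l => ?_
  rw [List.nodup_iff_getElem?_ne_getElem?]
  exact ⟨fun h i j hij hj => h j hj i hij, fun h j hj i hij => h i j hij hj⟩

theorem primrec_nat_pow : Primrec₂ fun a b : ℕ => a ^ b := by
  refine (nat_rec (f := fun _ : ℕ => 1) (g := fun a p => p.2 * a) (const 1)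
    (nat_mul.comp (snd.comp snd) fst).to₂).of_eq fun a b => ?_
  induction b with
  | zero => rfl
  | succ b ih => rw [pow_succ, ← ih]

theorem primrecRel_mem {α : Type*} [Primcodable α] :
    PrimrecRel fun (a : α) (l : List α) => a ∈ l := by
  have : PrimrecRel fun (b a : α) => b = a := Primrec.eq
  exact (this.exists_mem_list.comp snd fst).of_eq fun x => by simp

theorem primrecRel_certifies : PrimrecRel Certifies := by
  have h1 : PrimrecPred fun C : List (RatCode × RatCode) =>
      ∀ a ∈ C, ∀ b ∈ C, a = b ∨ Separated a b := by
    have hb : PrimrecRel fun b a : RatCode × RatCode => a = b ∨ Separated a b :=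
      (Primrec.eq.comp snd fst).or (primrecRel_separated.comp snd fst)
    have ha : PrimrecRel fun (a : RatCode × RatCode) (C : List (RatCode × RatCode)) =>
        ∀ b ∈ C, a = b ∨ Separated a b := hb.forall_mem_list.comp snd fst
    exact ha.forall_mem_list.comp Primrec.id Primrec.id
  have h2 : PrimrecRel fun (w : List ((RatCode × RatCode) × ℕ)) (C : List (RatCode × RatCode)) =>
      ∀ p ∈ w, p.1 ∈ C ∧ 0 < p.2 := by
    have hp : PrimrecRel fun (p : (RatCode × RatCode) × ℕ) (C : List (RatCode × RatCode)) =>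
        p.1 ∈ C ∧ 0 < p.2 :=
      (primrecRel_mem.comp (fst.comp fst) snd).and (nat_lt.comp (const 0) (snd.comp fst))
    exact hp.forall_mem_list
  have h3 : PrimrecRel fun (L : List (List (List (RatCode × RatCode))))
      (w : List ((RatCode × RatCode) × ℕ)) => ∃ l ∈ L, ∀ τ ∈ l, Fits τ w :=
    primrecRel_fits.forall_mem_list.exists_mem_list
  have h4 : PrimrecRel fun (x : Item) (y : (List (List (List (RatCode × RatCode))) × RatCode) ×
      Certificate) => x.2.length = y.2.1.2.2 ∧ 0 < x.1 ∧ (∀ p ∈ x.2, p.1 ∈ y.2.1.1 ∧ 0 < p.2) ∧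
      ∃ l ∈ y.1.1, ∀ τ ∈ l, Fits τ x.2 :=
    (Primrec.eq.comp (list_length.comp (snd.comp fst))
      (snd.comp (snd.comp (fst.comp (snd.comp snd))))).and
    ((nat_lt.comp (const 0) (fst.comp fst)).and
    ((h2.comp (snd.comp fst) (fst.comp (fst.comp (snd.comp snd)))).and
    (h3.comp (fst.comp (fst.comp snd)) (snd.comp fst))))
  have hpow : Primrec fun y : (List (List (List (RatCode × RatCode))) × RatCode) × Certificate =>
      (y.2.1.2.1 + 1) ^ (y.2.1.2.2 + 1) :=
    primrec_nat_pow.comp (succ.comp (fst.comp (snd.comp (fst.comp snd))))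
      (succ.comp (snd.comp (snd.comp (fst.comp snd))))
  have hq : Primrec fun y : (List (List (List (RatCode × RatCode))) × RatCode) × Certificate =>
      y.1.2 := snd.comp fst
  exact (h1.comp (fst.comp (fst.comp snd))).and ((primrecPred_nodup.comp (snd.comp snd)).and
    ((h4.forall_mem_list.comp (snd.comp snd) Primrec.id).and
    (nat_lt.comp (nat_mul.comp (fst.comp hq) hpow)
      (nat_add.comp (nat_mul.comp (list_length.comp (snd.comp snd))
        (succ.comp (snd.comp (snd.comp hq)))) (nat_mul.comp (fst.comp (snd.comp hq)) hpow)))))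

theorem primrec_itemName : Primrec₂ itemName := by
  have hc : Primrec fun y : (ℕ × Item) × (RatCode × RatCode) × ℕ =>
      (([[y.2.1]], (y.2.2, 0, y.1.1)) : List (List (RatCode × RatCode)) × RatCode) :=
    Primrec.pair (list_cons.comp (list_cons.comp (fst.comp snd) (const [])) (const []))
      (Primrec.pair (snd.comp snd) (Primrec.pair (const 0) (fst.comp fst)))
  exact Primrec.pair (list_cons.comp (list_map (snd.comp snd) hc.to₂) (const []))
    (Primrec.pair (fst.comp snd) (Primrec.pair (const 0) fst))

end Primrec

/-- The program that searches for a certificate. -/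
theorem exists_computesFrom_of_certifies : ∃ c : OracleCode, ∀ A B : Set ℕ,
    (∀ n, n ∈ A ↔ ∃ i, Encodable.encode i = n ∧ ∃ k, Certifies i k ∧
      ∀ x ∈ k.2, Encodable.encode (itemName k.1.2.1 x) ∈ B) → c.ComputesFrom A B := by
  have hw : Primrec fun k : Certificate =>
      k.2.map fun x => Encodable.encode (itemName k.1.2.1 x) :=
    Primrec.list_map Primrec.snd (Primrec.encode.comp (primrec_itemName.comp
      (Primrec.fst.comp (Primrec.snd.comp (Primrec.fst.comp Primrec.fst))) Primrec.snd)).to₂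
  obtain ⟨c, hc⟩ := OracleCode.exists_computesFrom primrecRel_certifies hw
  exact ⟨c, fun A B h => hc A B fun n => (h n).trans (by simp only [List.forall_mem_map])⟩

/-! ### Integrals of products as counts of levels -/

/-- The number of positive multiples of `1 / K` up to `1` that are less than `x`. -/
noncomputable def levelCount (K : ℕ) (x : ℝ) : ℕ :=
  ((Finset.Icc 1 K).filter fun n : ℕ => (n : ℝ) < K * x).card

theorem levelCount_le {K : ℕ} {x : ℝ} (hx : 0 ≤ x) : (levelCount K x : ℝ) ≤ K * x := by
  have h0 : 0 ≤ (K : ℝ) * x := by positivity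
  have : levelCount K x ≤ (Finset.Icc 1 ⌊(K : ℝ) * x⌋₊).card := by
    refine Finset.card_le_card fun n hn => ?_
    simp only [Finset.mem_filter, Finset.mem_Icc] at hn ⊢
    exact ⟨hn.1.1, Nat.le_floor hn.2.le⟩
  rw [Nat.card_Icc, Nat.add_sub_cancel] at this
  exact (Nat.cast_le.2 this).trans (Nat.floor_le h0)

/-- Every positive `n < ⌈K * x⌉` is counted: because of `x ≤ 1` the cap `K` removes none of them. -/
theorem le_levelCount {K : ℕ} {x : ℝ} (hx : x ≤ 1) : K * x - 1 ≤ levelCount K x := by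
  have hK : (K : ℝ) * x ≤ K := mul_le_of_le_one_right (Nat.cast_nonneg _) hx
  have h : (Finset.Icc 1 (⌈(K : ℝ) * x⌉₊ - 1)).card ≤ levelCount K x := by
    refine Finset.card_le_card fun n hn => ?_
    simp only [Finset.mem_filter, Finset.mem_Icc] at hn ⊢
    have hlt : n < ⌈(K : ℝ) * x⌉₊ := by omega
    have h2 : (n : ℝ) < K * x := Nat.lt_ceil.1 hlt
    exact ⟨⟨hn.1, by exact_mod_cast (h2.trans_le hK).le⟩, h2⟩
  rw [Nat.card_Icc, Nat.add_sub_cancel] at h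
  have h1 := Nat.le_ceil ((K : ℝ) * x)
  have h2 : (⌈(K : ℝ) * x⌉₊ : ℝ) ≤ levelCount K x + 1 := by exact_mod_cast (by omega)
  linarith

/-- Exchanging one factor at a time costs at most `δ`, since the other factors lie in `[0, 1]`. -/
theorem prod_sub_prod_le {ι : Type*} (s : Finset ι) {x y : ι → ℝ} {δ : ℝ} (hy : ∀ i, 0 ≤ y i)
    (hyx : ∀ i, y i ≤ x i) (hx : ∀ i, x i ≤ 1) (h : ∀ i, x i - y i ≤ δ) :
    ∏ i ∈ s, x i - ∏ i ∈ s, y i ≤ s.card * δ := by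
  classical
  induction s using Finset.induction_on with
  | empty => simp
  | insert a s ha ih =>
    rw [Finset.prod_insert ha, Finset.prod_insert ha, Finset.card_insert_of_notMem ha]
    have h1 : ∏ i ∈ s, x i ≤ 1 :=
      Finset.prod_le_one (fun i _ => (hy i).trans (hyx i)) fun i _ => hx i
    have h0 : 0 ≤ ∏ i ∈ s, x i := Finset.prod_nonneg fun i _ => (hy i).trans (hyx i)
    have h2 : ∏ i ∈ s, y i ≤ ∏ i ∈ s, x i :=
      Finset.prod_le_prod (fun i _ => hy i) fun i _ => hyx i
    have h3 : (x a - y a) * ∏ i ∈ s, x i ≤ x a - y a :=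
      mul_le_of_le_one_right (by linarith [hyx a]) h1
    have h4 : y a * (∏ i ∈ s, x i - ∏ i ∈ s, y i) ≤ ∏ i ∈ s, x i - ∏ i ∈ s, y i :=
      mul_le_of_le_one_left (by linarith) ((hyx a).trans (hx a))
    push_cast
    linarith [h a]

/-- For fixed `j` the condition splits over the coordinates, so the admissible level vectors form a
product of finite sets. This turns products of masses into conjunctions of lower bounds. -/
theorem card_levels_eq_sum_prod {α : Type*} {N K : ℕ} (J : Finset (Fin N → α)) (x : α → ℝ) :
    ((J ×ˢ Fintype.piFinset fun _ : Fin N => Finset.Icc 1 K).filter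
      fun p => ∀ i, (p.2 i : ℝ) < K * x (p.1 i)).card =
      ∑ j ∈ J, ∏ i, levelCount K (x (j i)) := by
  classical
  rw [Finset.card_filter, Finset.sum_product]
  refine Finset.sum_congr rfl fun j _ => ?_
  rw [← Finset.card_filter]
  simp only [levelCount]
  rw [← Fintype.card_piFinset]
  congr 1
  ext n
  simp only [Finset.mem_filter, Fintype.mem_piFinset]
  exact ⟨fun h i => ⟨h.1 i, h.2 i⟩, fun h => ⟨fun i => (h i).1, fun i => (h i).2⟩⟩

/-- The sequences that start with elements of the sets `s (j 0), …, s (j (N - 1))`. -/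
def box {α : Type*} (s : α → Set ℝ) {N : ℕ} (j : Fin N → α) : Set (ℕ → ℝ) :=
  {x | ∀ i : Fin N, x i ∈ s (j i)}

theorem measurableSet_box {α : Type*} {s : α → Set ℝ} (hs : ∀ a, MeasurableSet (s a)) {N : ℕ}
    (j : Fin N → α) : MeasurableSet (box s j) := by
  have : box s j = ⋂ i : Fin N, (fun x : ℕ → ℝ => x i) ⁻¹' s (j i) := by
    ext x; simp [box]
  rw [this]
  exact MeasurableSet.iInter fun i => (measurable_pi_apply _) (hs _)

theorem infinitePi_box {α : Type*} {s : α → Set ℝ} (hs : ∀ a, MeasurableSet (s a)) {N : ℕ}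
    (j : Fin N → α) (γ : ProbabilityMeasure ℝ) :
    (Measure.infinitePi fun _ : ℕ => (γ : Measure ℝ)).real (box s j) =
      ∏ i, (γ : Measure ℝ).real (s (j i)) := by
  let t : ℕ → Set ℝ := fun i => if h : i < N then s (j ⟨i, h⟩) else Set.univ
  have ht : ∀ i : Fin N, t i = s (j i) := fun i => by simp [t]
  have : box s j = Set.pi (Finset.range N : Set ℕ) t := by
    ext x
    simp only [box, Set.mem_ofPred_eq, Set.mem_pi, Finset.coe_range, Set.mem_Iio]
    exact ⟨fun h i hi => by simpa [ht ⟨i, hi⟩] using h ⟨i, hi⟩,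
      fun h i => by simpa [ht] using h i i.2⟩
  rw [this, measureReal_def, Measure.infinitePi_pi, ENNReal.toReal_prod]
  · rw [Finset.prod_range]
    exact Finset.prod_congr rfl fun i _ => by rw [ht]; rfl
  · intro i hi
    have := ht ⟨i, Finset.mem_range.1 hi⟩
    simp only at this
    rw [this]
    exact hs _

theorem disjoint_box {α : Type*} {s : α → Set ℝ} {N : ℕ} {j k : Fin N → α} {i : Fin N}
    (h : Disjoint (s (j i)) (s (k i))) : Disjoint (box s j) (box s k) :=
  Set.disjoint_left.2 fun _ hx hy => Set.disjoint_left.1 h (hx i) (hy i)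

section Levels

variable {Ω α : Type*} [MeasurableSpace Ω] {P : Measure Ω}
  {X : ℕ → Ω → ℝ} {ν : Ω → ProbabilityMeasure ℝ} {s : α → Set ℝ} {N K : ℕ}
  {J : Finset (Fin N → α)}

/-- The levels that the certificate for the disjoint boxes `J` can have. -/
noncomputable def levels (P : Measure Ω) (ν : Ω → ProbabilityMeasure ℝ) (s : α → Set ℝ) (K : ℕ)
    (J : Finset (Fin N → α)) : Finset (((Fin N → α) × (Fin N → ℕ)) × ℕ) :=
  ((J ×ˢ Fintype.piFinset fun _ : Fin N => Finset.Icc 1 K) ×ˢ Finset.Icc 1 K).filter fun x =>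
    (x.2 : ℝ) < K * P.real {ω | ∀ i, (x.1.2 i : ℝ) < K * (ν ω : Measure ℝ).real (s (x.1.1 i))}

theorem card_levels :
    (levels P ν s K J).card = ∑ p ∈ J ×ˢ Fintype.piFinset fun _ : Fin N => Finset.Icc 1 K,
      levelCount K
        (P.real {ω | ∀ i, (p.2 i : ℝ) < K * (ν ω : Measure ℝ).real (s (p.1 i))}) := by
  rw [levels, Finset.card_filter, Finset.sum_product]
  simp only [levelCount, Finset.card_filter]

variable [IsProbabilityMeasure P]

/-- The expectation of a conditional probability. Integrability is inherited from the conditional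
expectation by almost sure equality. -/
theorem IsDirectingRandomMeasure.integral_eq (hX : ∀ i, Measurable (X i))
    (hν : IsDirectingRandomMeasure P X ν) {B : Set (ℕ → ℝ)} (hB : MeasurableSet B) :
    Integrable (fun ω => (Measure.infinitePi fun _ : ℕ => (ν ω : Measure ℝ)).real B) P ∧
    ∫ ω, (Measure.infinitePi fun _ : ℕ => (ν ω : Measure ℝ)).real B ∂P =
      P.real ((fun ω i => X i ω) ⁻¹' B) := by
  have hm := hν.measurable.comap_le
  have h := hν.condExp_eq B hB
  have hXB : MeasurableSet ((fun ω i => X i ω) ⁻¹' B) := (measurable_pi_lambda _ hX) hB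
  refine ⟨integrable_condExp.congr h, ?_⟩
  rw [← integral_congr_ae h, integral_condExp hm]
  exact integral_indicator_one hXB

theorem measurableSet_levels (hν : Measurable ν) (hs : ∀ a, MeasurableSet (s a))
    (j : Fin N → α) (n : Fin N → ℕ) :
    MeasurableSet {ω | ∀ i, (n i : ℝ) < K * (ν ω : Measure ℝ).real (s (j i))} := by
  have : {ω | ∀ i, (n i : ℝ) < K * (ν ω : Measure ℝ).real (s (j i))} =
      ⋂ i, {ω | (n i : ℝ) < K * (ν ω : Measure ℝ).real (s (j i))} := by ext; simp
  rw [this]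
  refine MeasurableSet.iInter fun i => measurableSet_lt measurable_const ?_
  exact (((Measure.measurable_coe (hs _)).comp (measurable_subtype_coe.comp hν)).ennreal_toReal
    ).const_mul _

/-- At each `ω` the integrand counts the events that contain `ω`, so it is a finite sum of
indicators. -/
theorem sum_measureReal_levels (hν : Measurable ν) (hs : ∀ a, MeasurableSet (s a)) :
    Integrable (fun ω => ∑ j ∈ J, ∏ i, (levelCount K ((ν ω : Measure ℝ).real (s (j i))) : ℝ)) P ∧
    ∑ p ∈ J ×ˢ Fintype.piFinset fun _ : Fin N => Finset.Icc 1 K,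
      P.real {ω | ∀ i, (p.2 i : ℝ) < K * (ν ω : Measure ℝ).real (s (p.1 i))} =
      ∫ ω, ∑ j ∈ J, ∏ i, (levelCount K ((ν ω : Measure ℝ).real (s (j i))) : ℝ) ∂P := by
  classical
  have h : ∀ ω, ∑ j ∈ J, ∏ i, (levelCount K ((ν ω : Measure ℝ).real (s (j i))) : ℝ) =
      ∑ p ∈ J ×ˢ Fintype.piFinset fun _ : Fin N => Finset.Icc 1 K,
        {ω | ∀ i, (p.2 i : ℝ) < K * (ν ω : Measure ℝ).real (s (p.1 i))}.indicator 1 ω := by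
    intro ω
    have := card_levels_eq_sum_prod (K := K) J fun a => (ν ω : Measure ℝ).real (s a)
    rw [Finset.card_filter] at this
    have h2 := congrArg (Nat.cast : ℕ → ℝ) this
    push_cast at h2
    rw [← h2]
    exact Finset.sum_congr rfl fun p _ => by simp [Set.indicator_apply]
  have hi : ∀ p : (Fin N → α) × (Fin N → ℕ), Integrable
      ({ω | ∀ i, (p.2 i : ℝ) < K * (ν ω : Measure ℝ).real (s (p.1 i))}.indicator
        (1 : Ω → ℝ)) P := fun p =>
    (integrable_const (1 : ℝ)).indicator (measurableSet_levels hν hs p.1 p.2)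
  simp_rw [h]
  refine ⟨integrable_finsetSum _ fun p _ => hi p, ?_⟩
  rw [integral_finsetSum _ fun p _ => hi p]
  exact Finset.sum_congr rfl fun p _ =>
    (integral_indicator_one (measurableSet_levels hν hs p.1 p.2)).symm

theorem infinitePi_biUnion_box (hs : ∀ a, MeasurableSet (s a))
    (hJ : ∀ j ∈ J, ∀ k ∈ J, j ≠ k → ∃ i, Disjoint (s (j i)) (s (k i)))
    (γ : ProbabilityMeasure ℝ) :
    (Measure.infinitePi fun _ : ℕ => (γ : Measure ℝ)).real (⋃ j ∈ J, box s j) =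
      ∑ j ∈ J, ∏ i, (γ : Measure ℝ).real (s (j i)) := by
  rw [measureReal_biUnion_finset]
  · exact Finset.sum_congr rfl fun j _ => infinitePi_box hs j γ
  · intro j hj k hk hjk
    obtain ⟨i, hi⟩ := hJ j hj k hk hjk
    exact disjoint_box hi
  · exact fun j _ => measurableSet_box hs j

/-- Both counts round down. The level of the probability contributes one factor `K`, the levels of
the `N` sides contribute `K ^ N`. -/
theorem IsDirectingRandomMeasure.card_levels_le (hX : ∀ i, Measurable (X i))
    (hν : IsDirectingRandomMeasure P X ν) (hs : ∀ a, MeasurableSet (s a))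
    (hJ : ∀ j ∈ J, ∀ k ∈ J, j ≠ k → ∃ i, Disjoint (s (j i)) (s (k i))) :
    ((levels P ν s K J).card : ℝ) ≤
      K ^ (N + 1) * P.real ((fun ω i => X i ω) ⁻¹' ⋃ j ∈ J, box s j) := by
  have hB : MeasurableSet (⋃ j ∈ J, box s j) :=
    Finset.measurableSet_biUnion _ fun j _ => measurableSet_box hs j
  obtain ⟨hi, he⟩ := hν.integral_eq hX hB
  obtain ⟨hi', he'⟩ := sum_measureReal_levels (P := P) (K := K) (J := J) hν.measurable hs
  rw [card_levels, ← he]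
  push_cast
  calc _ ≤ ∑ p ∈ J ×ˢ Fintype.piFinset fun _ : Fin N => Finset.Icc 1 K, (K : ℝ) *
        P.real {ω | ∀ i, (p.2 i : ℝ) < K * (ν ω : Measure ℝ).real (s (p.1 i))} :=
        Finset.sum_le_sum fun p _ => levelCount_le measureReal_nonneg
    _ = K * ∫ ω, ∑ j ∈ J, ∏ i, (levelCount K ((ν ω : Measure ℝ).real (s (j i))) : ℝ) ∂P := by
        rw [← Finset.mul_sum, he']
    _ ≤ K * ∫ ω, K ^ N *
        (Measure.infinitePi fun _ : ℕ => (ν ω : Measure ℝ)).real (⋃ j ∈ J, box s j) ∂P := by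
        refine mul_le_mul_of_nonneg_left (integral_mono hi' (hi.const_mul _) fun ω => ?_)
          (Nat.cast_nonneg _)
        simp only
        rw [infinitePi_biUnion_box hs hJ, Finset.mul_sum]
        refine Finset.sum_le_sum fun j _ => ?_
        calc _ ≤ ∏ i, (K * (ν ω : Measure ℝ).real (s (j i))) :=
              Finset.prod_le_prod (fun _ _ => Nat.cast_nonneg _)
                fun _ _ => levelCount_le measureReal_nonneg
          _ = _ := by simp [Finset.prod_mul_distrib]
    _ = _ := by rw [integral_const_mul]; ring

/-- Rounding the probabilities loses at most `1` for each of the `J.card * K ^ N` events. Rounding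
the sides loses at most `N / K` in each product, which is `K ^ N * N` after scaling by `K ^ (N +
1)`. -/
theorem IsDirectingRandomMeasure.le_card_levels (hX : ∀ i, Measurable (X i))
    (hν : IsDirectingRandomMeasure P X ν) (hs : ∀ a, MeasurableSet (s a))
    (hJ : ∀ j ∈ J, ∀ k ∈ J, j ≠ k → ∃ i, Disjoint (s (j i)) (s (k i))) (hK : 0 < K) :
    K ^ (N + 1) * P.real ((fun ω i => X i ω) ⁻¹' ⋃ j ∈ J, box s j) ≤
      (levels P ν s K J).card + K ^ N * (J.card * (N + 1)) := by
  have hK' : (0 : ℝ) < K := by exact_mod_cast hK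
  have hB : MeasurableSet (⋃ j ∈ J, box s j) :=
    Finset.measurableSet_biUnion _ fun j _ => measurableSet_box hs j
  obtain ⟨hi, he⟩ := hν.integral_eq hX hB
  obtain ⟨hi', he'⟩ := sum_measureReal_levels (P := P) (K := K) (J := J) hν.measurable hs
  have h1 : ∑ p ∈ J ×ˢ Fintype.piFinset fun _ : Fin N => Finset.Icc 1 K, ((K : ℝ) *
        P.real {ω | ∀ i, (p.2 i : ℝ) < K * (ν ω : Measure ℝ).real (s (p.1 i))} - 1) ≤
      (levels P ν s K J).card := by
    rw [card_levels]
    push_cast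
    exact Finset.sum_le_sum fun p _ => le_levelCount measureReal_le_one
  rw [Finset.sum_sub_distrib, ← Finset.mul_sum, he'] at h1
  simp only [Finset.sum_const, Finset.card_product, Fintype.card_piFinset, Nat.card_Icc,
    Nat.add_sub_cancel, Finset.prod_const, Finset.card_univ, Fintype.card_fin, nsmul_eq_mul,
    Nat.cast_mul, Nat.cast_pow, mul_one] at h1
  have h2 : ∫ ω, (K ^ N * (Measure.infinitePi fun _ : ℕ => (ν ω : Measure ℝ)).real
      (⋃ j ∈ J, box s j) - K ^ N * (J.card * (N * (1 / K)))) ∂P ≤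
      ∫ ω, ∑ j ∈ J, ∏ i, (levelCount K ((ν ω : Measure ℝ).real (s (j i))) : ℝ) ∂P := by
    refine integral_mono ((hi.const_mul _).sub (integrable_const _)) hi' fun ω => ?_
    simp only
    rw [infinitePi_biUnion_box hs hJ, ← nsmul_eq_mul J.card, ← Finset.sum_const, ← mul_sub,
      ← Finset.sum_sub_distrib, Finset.mul_sum]
    refine Finset.sum_le_sum fun j _ => ?_
    have h := prod_sub_prod_le Finset.univ (x := fun i => (ν ω : Measure ℝ).real (s (j i)))
      (y := fun i => (levelCount K ((ν ω : Measure ℝ).real (s (j i))) : ℝ) / K) (δ := 1 / K)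
      (fun i => by positivity)
      (fun i => by
        rw [div_le_iff₀' hK']
        exact levelCount_le measureReal_nonneg)
      (fun i => measureReal_le_one)
      (fun i => by
        have := le_levelCount (K := K) (x := (ν ω : Measure ℝ).real (s (j i))) measureReal_le_one
        rw [sub_le_iff_le_add, ← add_div, le_div_iff₀' hK']
        linarith)
    rw [Finset.prod_div_distrib] at h
    simp only [Finset.prod_const, Finset.card_univ, Fintype.card_fin] at h
    have h' := mul_le_mul_of_nonneg_left h (by positivity : (0 : ℝ) ≤ K ^ N)
    rw [mul_sub, mul_div_cancel₀ _ (by positivity)] at h'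
    rw [mul_sub]
    linarith
  rw [integral_sub (hi.const_mul _) (integrable_const _), integral_const_mul, he] at h2
  simp only [integral_const, probReal_univ, smul_eq_mul, one_mul] at h2
  have h3 := mul_le_mul_of_nonneg_left h2 hK'.le
  have h4 : (K : ℝ) * (K ^ N * (J.card * (N * (1 / K)))) = K ^ N * (J.card * N) := by
    field_simp
  rw [mul_sub, h4] at h3
  rw [pow_succ']
  nlinarith [h1, h3]

end Levels

/-! ### Almost covering the line by disjoint rational intervals -/

theorem exists_measureReal_le_of_antitone (ρ : Measure ℝ) [IsFiniteMeasure ρ] {S : ℕ → Set ℝ}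
    (hS : ∀ n, MeasurableSet (S n)) (ha : Antitone S) (he : ⋂ n, S n = ∅) {ε : ℝ} (hε : 0 < ε) :
    ∃ n, ρ.real (S n) ≤ ε := by
  have h := tendsto_measure_iInter_atTop (μ := ρ) (fun n => (hS n).nullMeasurableSet) ha
    ⟨0, measure_ne_top _ _⟩
  rw [he, measure_empty] at h
  have h' := (ENNReal.tendsto_toReal ENNReal.zero_ne_top).comp h
  obtain ⟨n, hn⟩ := (h'.eventually (Iic_mem_nhds (show (0 : ENNReal).toReal < ε by simpa using hε))).exists
  exact ⟨n, hn⟩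

/-- Punctured intervals around `e` shrink to the empty set; `e` itself has to be left out because it
may be an atom. -/
theorem exists_punctured_interval (ρ : Measure ℝ) [IsFiniteMeasure ρ] (e : ℚ) {ε : ℝ}
    (hε : 0 < ε) : ∃ u v : ℚ, u < e ∧ e < v ∧ ρ.real (Set.Icc (u : ℝ) v \ {(e : ℝ)}) ≤ ε := by
  obtain ⟨n, hn⟩ := exists_measureReal_le_of_antitone ρ
    (S := fun n : ℕ => Set.Icc ((e : ℝ) - 1 / (n + 1)) (e + 1 / (n + 1)) \ {(e : ℝ)})
    (fun n => measurableSet_Icc.diff (measurableSet_singleton _))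
    (fun m n hmn => Set.sdiff_subset_sdiff_left (Set.Icc_subset_Icc
      (sub_le_sub_left (Nat.one_div_le_one_div hmn) _)
      (by linarith [Nat.one_div_le_one_div (α := ℝ) hmn])))
    (by
      refine Set.eq_empty_iff_forall_notMem.2 fun x hx => ?_
      simp only [Set.mem_iInter, Set.mem_sdiff, Set.mem_Icc, Set.mem_singleton_iff] at hx
      have hne : 0 < |x - e| := abs_pos.2 (sub_ne_zero.2 (hx 0).2)
      obtain ⟨n, hn⟩ := exists_nat_one_div_lt hne
      have := hx n
      rcases abs_cases (x - e) with h | h <;> linarith [this.1.1, this.1.2]) hε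
  refine ⟨e - 1 / (n + 1), e + 1 / (n + 1), ?_, ?_, ?_⟩
  · linarith [Nat.one_div_pos_of_nat (α := ℚ) (n := n)]
  · linarith [Nat.one_div_pos_of_nat (α := ℚ) (n := n)]
  · push_cast
    exact hn

theorem exists_bounded_interval (ρ : Measure ℝ) [IsFiniteMeasure ρ] {ε : ℝ} (hε : 0 < ε) :
    ∃ n : ℕ, ρ.real (Set.Ioo (-(n : ℝ)) n)ᶜ ≤ ε := by
  refine exists_measureReal_le_of_antitone ρ (S := fun n : ℕ => (Set.Ioo (-(n : ℝ)) n)ᶜ)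
    (fun n => measurableSet_Ioo.compl) (fun m n hmn => ?_) ?_ hε
  · have : (m : ℝ) ≤ n := by exact_mod_cast hmn
    exact Set.compl_subset_compl.2 (Set.Ioo_subset_Ioo (by linarith) this)
  · refine Set.eq_empty_iff_forall_notMem.2 fun x hx => ?_
    simp only [Set.mem_iInter, Set.mem_compl_iff, Set.mem_Ioo] at hx
    obtain ⟨n, hn⟩ := exists_nat_gt |x|
    exact hx n (abs_lt.1 hn)

/-- Up to a set of small measure, the line is the union of finitely many disjoint open intervals
with rational endpoints each of which lies on the same side of the given rational numbers as the
points that it has to cover. -/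
theorem exists_cells (ρ : Measure ℝ) [IsFiniteMeasure ρ] (E : Finset ℚ) {ε : ℝ} (hε : 0 < ε) :
    ∃ C : Finset (ℚ × ℚ), (∀ a ∈ C, ∀ b ∈ C, a ≠ b → min a.2 b.2 ≤ max a.1 b.1) ∧
      ∃ Z : Set ℝ, ρ.real Z ≤ ε ∧ ∀ x ∉ Z, ∃ I ∈ C, (I.1 : ℝ) < x ∧ x < I.2 ∧
        ∀ e ∈ E, (x < e → I.2 ≤ e) ∧ (e < x → e ≤ I.1) := by
  classical
  induction E using Finset.induction_on generalizing ε with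
  | empty =>
    obtain ⟨n, hn⟩ := exists_bounded_interval ρ hε
    refine ⟨{(-(n : ℚ), (n : ℚ))}, by simp, _, hn, fun x hx => ⟨_, Finset.mem_singleton_self _, ?_⟩⟩
    simpa using hx
  | insert e E _ ih =>
    obtain ⟨C, hC, Z, hZ, h⟩ := ih (half_pos hε)
    obtain ⟨u, v, hu, hv, huv⟩ := exists_punctured_interval ρ e (half_pos hε)
    -- Each cell is cut at `u` and `v`, and `[u, v]` without `e` is given up. The middle piece may
    -- straddle `e`: the only point that it still has to cover is `e`, which is on neither side of
    -- itself. Pieces may be empty.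
    let f₁ : ℚ × ℚ → ℚ × ℚ := fun I => (I.1, min I.2 u)
    let f₂ : ℚ × ℚ → ℚ × ℚ := fun I => (max I.1 u, min I.2 v)
    let f₃ : ℚ × ℚ → ℚ × ℚ := fun I => (max I.1 v, I.2)
    refine ⟨C.image f₁ ∪ C.image f₂ ∪ C.image f₃, ?_, Z ∪ (Set.Icc (u : ℝ) v \ {(e : ℝ)}),
      (measureReal_union_le _ _).trans (by linarith), fun x hx => ?_⟩
    · have hI : ∀ I ∈ C, ∀ I' ∈ C, ∀ f : ℚ × ℚ → ℚ × ℚ, f I ≠ f I' →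
          min I.2 I'.2 ≤ max I.1 I'.1 := fun I hI I' hI' f hf =>
        hC I hI I' hI' fun h => hf (h ▸ rfl)
      intro a ha b hb hab
      simp only [Finset.mem_union, Finset.mem_image] at ha hb
      rcases ha with (⟨I, hIC, rfl⟩ | ⟨I, hIC, rfl⟩) | ⟨I, hIC, rfl⟩ <;>
      rcases hb with (⟨I', hIC', rfl⟩ | ⟨I', hIC', rfl⟩) | ⟨I', hIC', rfl⟩
      -- Pieces of the same kind inherit the separation of their cells; pieces of different kinds
      -- are separated by `u` or `v`.
      all_goals first
        | have := hI I hIC I' hIC' f₁ hab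
          grind
        | have := hI I hIC I' hIC' f₂ hab
          grind
        | have := hI I hIC I' hIC' f₃ hab
          grind
        | grind
    · simp only [Set.mem_union, Set.mem_sdiff, Set.mem_Icc, Set.mem_singleton_iff, not_or, not_and,
        not_not] at hx
      obtain ⟨I, hIC, h1, h2, h3⟩ := h x hx.1
      have hu' : (u : ℝ) < e := by exact_mod_cast hu
      have hv' : (e : ℝ) < v := by exact_mod_cast hv
      rcases lt_or_ge x u with hxu | hxu
      · refine ⟨f₁ I, by simp only [Finset.mem_union, Finset.mem_image]; grind, h1, ?_, ?_⟩
        · simp only [f₁]; push_cast; exact lt_min h2 hxu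
        · intro e' he'
          rcases Finset.mem_insert.1 he' with rfl | he'
          · exact ⟨fun _ => (min_le_right _ _).trans hu.le, fun h => by linarith⟩
          · exact ⟨fun h => (min_le_left _ _).trans ((h3 e' he').1 h), (h3 e' he').2⟩
      rcases lt_or_ge (v : ℝ) x with hxv | hxv
      · refine ⟨f₃ I, by simp only [Finset.mem_union, Finset.mem_image]; grind, ?_, h2, ?_⟩
        · simp only [f₃]; push_cast; exact max_lt h1 hxv
        · intro e' he'
          rcases Finset.mem_insert.1 he' with rfl | he'
          · exact ⟨fun h => by linarith, fun _ => hv.le.trans (le_max_right _ _)⟩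
          · exact ⟨(h3 e' he').1, fun h => ((h3 e' he').2 h).trans (le_max_left _ _)⟩
      have hxe : x = e := hx.2 ⟨hxu, hxv⟩
      refine ⟨f₂ I, by simp only [Finset.mem_union, Finset.mem_image]; grind, ?_, ?_, ?_⟩
      · simp only [f₂]; push_cast; exact max_lt h1 (hxe ▸ hu')
      · simp only [f₂]; push_cast; exact lt_min h2 (hxe ▸ hv')
      · intro e' he'
        rcases Finset.mem_insert.1 he' with rfl | he'
        · exact ⟨fun h => absurd hxe h.ne, fun h => absurd hxe h.ne'⟩
        · exact ⟨fun h => (min_le_left _ _).trans ((h3 e' he').1 h),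
            fun h => ((h3 e' he').2 h).trans (le_max_left _ _)⟩

/-! ### Names of intervals, cylinders and items -/

theorem exists_ratOf_eq (r : ℚ) : ∃ p : RatCode, ratOf p = r := by
  refine ⟨(r.num.toNat, (-r.num).toNat, r.den - 1), ?_⟩
  have h1 : ((r.num.toNat : ℤ) : ℚ) - ((-r.num).toNat : ℤ) = r.num := by
    rw [← Int.cast_sub, Int.toNat_sub_toNat_neg]
  have h2 : ((r.den - 1 : ℕ) : ℚ) + 1 = r.den := by
    rw [← Nat.cast_add_one, Nat.sub_add_cancel r.den_pos]
  simp only [ratOf, h2]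
  push_cast at h1
  rw [h1, Rat.num_div_den]

theorem Separated.disjoint {a b : RatCode × RatCode} (h : Separated a b) :
    Disjoint (ratInterval a) (ratInterval b) := by
  simp only [Separated, ratLE_iff] at h
  simp only [ratInterval, Set.Ioo_disjoint_Ioo]
  rcases h with (h | h) | (h | h)
  · exact (min_le_left _ _).trans (le_max_of_le_right (by exact_mod_cast h))
  · exact (min_le_right _ _).trans (le_max_of_le_left (by exact_mod_cast h))
  · exact (min_le_left _ _).trans (le_max_of_le_left (by exact_mod_cast h))
  · exact (min_le_right _ _).trans (le_max_of_le_right (by exact_mod_cast h))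

theorem measurableSet_ratInterval (a : RatCode × RatCode) : MeasurableSet (ratInterval a) :=
  measurableSet_Ioo

theorem measurableSet_latticeSet {ι S : Type*} [MeasurableSpace S] {s : ι → Set S}
    (hs : ∀ i, MeasurableSet (s i)) (L : List (List ι)) : MeasurableSet (latticeSet s L) := by
  have : latticeSet s L = ⋃ l ∈ {l | l ∈ L}, ⋂ i ∈ {i | i ∈ l}, s i := by
    ext x
    simp [latticeSet]
  rw [this]
  exact MeasurableSet.biUnion (List.finite_toSet L).countable fun l _ =>
    MeasurableSet.biInter (List.finite_toSet l).countable fun i _ => hs i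

theorem measurableSet_ratCylinder (τ : List (RatCode × RatCode)) :
    MeasurableSet (ratCylinder τ) := by
  have : ratCylinder τ = ⋂ (i : ℕ) (hi : i < τ.length),
      (fun x : ℕ → ℝ => x i) ⁻¹' ratInterval τ[i] := by
    ext x
    simp [ratCylinder]
  rw [this]
  exact MeasurableSet.iInter fun i => MeasurableSet.iInter fun hi =>
    (measurable_pi_apply i) (measurableSet_ratInterval _)

/-- The box with the sides `j` lies in the cylinder `τ`. -/
def FitsWord (τ : List (RatCode × RatCode)) {N : ℕ} (j : Fin N → RatCode × RatCode) : Prop :=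
  ∀ (i : ℕ) (hi : i < τ.length), ∃ h : i < N,
    ratOf τ[i].1 ≤ ratOf (j ⟨i, h⟩).1 ∧ ratOf (j ⟨i, h⟩).2 ≤ ratOf τ[i].2

theorem FitsWord.box_subset {τ : List (RatCode × RatCode)} {N : ℕ}
    {j : Fin N → RatCode × RatCode} (h : FitsWord τ j) : box ratInterval j ⊆ ratCylinder τ := by
  intro x hx i hi
  obtain ⟨hN, h1, h2⟩ := h i hi
  exact Set.Ioo_subset_Ioo (by exact_mod_cast h1) (by exact_mod_cast h2) (hx ⟨i, hN⟩)

theorem fits_iff {τ : List (RatCode × RatCode)} {w : List ((RatCode × RatCode) × ℕ)} {N : ℕ}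
    (hw : w.length = N) : Fits τ w ↔ FitsWord τ fun i : Fin N => (w.getD i 0).1 := by
  simp only [Fits, FitsWord, ratLE_iff]
  constructor
  · rintro ⟨h1, h2⟩ i hi
    have := h2 i hi
    rw [List.getD_eq_getElem _ _ hi] at this
    exact ⟨by omega, this⟩
  · intro h
    refine ⟨?_, fun i hi => ?_⟩
    · by_contra! hlt
      obtain ⟨h', -⟩ := h w.length hlt
      omega
    · rw [List.getD_eq_getElem _ _ hi]
      exact (h i hi).2

/-- The intervals, their levels and the level of an item. -/
def Item.toWord (N : ℕ) (x : Item) : ((Fin N → RatCode × RatCode) × (Fin N → ℕ)) × ℕ :=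
  ((fun i => (x.2.getD i 0).1, fun i => (x.2.getD i 0).2), x.1)

/-- The item with the given intervals and levels. -/
def Item.ofWord {N : ℕ} (y : ((Fin N → RatCode × RatCode) × (Fin N → ℕ)) × ℕ) : Item :=
  (y.2, List.ofFn fun i => (y.1.1 i, y.1.2 i))

theorem Item.ofWord_toWord {N : ℕ} {x : Item} (hx : x.2.length = N) :
    ofWord (x.toWord N) = x := by
  refine Prod.ext rfl (List.ext_getElem (by simp [ofWord, hx]) fun i h1 h2 => ?_)
  simp [ofWord, toWord, h2]

theorem Item.toWord_ofWord {N : ℕ} (y : ((Fin N → RatCode × RatCode) × (Fin N → ℕ)) × ℕ) :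
    (ofWord y).toWord N = y := by
  obtain ⟨⟨j, n⟩, t⟩ := y
  simp [ofWord, toWord]

theorem Item.forall_mem_iff {N : ℕ} {x : Item} (hx : x.2.length = N)
    {Q : (RatCode × RatCode) × ℕ → Prop} :
    (∀ p ∈ x.2, Q p) ↔ ∀ i : Fin N, Q ((x.toWord N).1.1 i, (x.toWord N).1.2 i) := by
  subst hx
  rw [List.forall_mem_iff_getElem]
  constructor
  · intro h i
    simpa [toWord] using h i i.2
  · intro h i hi
    simpa [toWord, hi] using h ⟨i, hi⟩

theorem mem_pointRep_iff {ι S : Type*} [Encodable ι] {s : ι → Set S} {x : S} {i : ι} :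
    Encodable.encode i ∈ pointRep s x ↔ x ∈ s i :=
  ⟨fun ⟨_, hj, hx⟩ => Encodable.encode_injective hj ▸ hx, fun h => ⟨i, rfl, h⟩⟩

theorem ratOf_level (n D : ℕ) : (ratOf (n, 0, D) : ℝ) = n / (D + 1 : ℕ) := by
  simp [ratOf]

theorem latticeSet_measureSubbasis (D : ℕ) (w : List ((RatCode × RatCode) × ℕ)) :
    latticeSet (measureSubbasis ratInterval)
      [w.map fun p => (([[p.1]], (p.2, 0, D)) : List (List (RatCode × RatCode)) × RatCode)] =
      {γ : ProbabilityMeasure ℝ | ∀ p ∈ w, (p.2 : ℝ) < (D + 1 : ℕ) * (γ : Measure ℝ).real (ratInterval p.1)} := by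
  ext γ
  have hD : (0 : ℝ) < (D + 1 : ℕ) := by positivity
  simp only [latticeSet, List.mem_singleton, exists_eq_left, Set.mem_ofPred_eq,
    List.forall_mem_map, measureSubbasis]
  refine forall₂_congr fun p _ => ?_
  have h : {x | ∀ i, i = p.1 → x ∈ ratInterval i} = ratInterval p.1 := by ext; simp
  rw [h, ratOf_level, div_lt_iff₀' hD]

/-! ### Soundness and completeness of certificates -/

section Law

variable {Ω : Type*} [MeasurableSpace Ω] {P : Measure Ω}
  {X : ℕ → Ω → ℝ} {ν : Ω → ProbabilityMeasure ℝ}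
  {χ : ProbabilityMeasure (ℕ → ℝ)} {μ : ProbabilityMeasure (ProbabilityMeasure ℝ)}

/-- The link between the representation of `μ` and `levels`: the right side is the condition that
defines `levels` for `K = D + 1`. -/
theorem encode_itemName_mem_iff (hμ : HasLaw ν (μ : Measure (ProbabilityMeasure ℝ)) P) {D N : ℕ} {x : Item}
    (hx : x.2.length = N) :
    Encodable.encode (itemName D x) ∈ measureLawRep μ ↔
      ((x.toWord N).2 : ℝ) < (D + 1 : ℕ) * P.real {ω | ∀ i, ((x.toWord N).1.2 i : ℝ) <
        (D + 1 : ℕ) * (ν ω : Measure ℝ).real (ratInterval ((x.toWord N).1.1 i))} := by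
  have hD : (0 : ℝ) < (D + 1 : ℕ) := by positivity
  refine mem_pointRep_iff.trans ?_
  have hm := measurableSet_levels (K := D + 1) (ν := id) measurable_id measurableSet_ratInterval
    (x.toWord N).1.1 (x.toWord N).1.2
  simp only [id_eq] at hm
  rw [hμ.measureReal_eq hm, ← div_lt_iff₀' hD, ← ratOf_level]
  simp only [itemName, measureSubbasis, Set.mem_ofPred_eq]
  have : latticeSet (measureSubbasis ratInterval) [x.2.map fun p =>
      (([[p.1]], (p.2, 0, D)) : List (List (RatCode × RatCode)) × RatCode)] =
      {γ : ProbabilityMeasure ℝ | ∀ i, ((x.toWord N).1.2 i : ℝ) <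
        (D + 1 : ℕ) * (γ : Measure ℝ).real (ratInterval ((x.toWord N).1.1 i))} := by
    rw [latticeSet_measureSubbasis]
    ext γ
    exact Item.forall_mem_iff hx
  exact Iff.of_eq (congrArg (fun A => (ratOf (x.1, 0, D) : ℝ) < (μ : Measure _).real A) this)

theorem ratOf_lt_iff (q : RatCode) (x : ℝ) :
    (ratOf q : ℝ) < x ↔ (q.1 : ℝ) < x * (q.2.2 + 1) + q.2.1 := by
  have : (0 : ℝ) < q.2.2 + 1 := by positivity
  simp only [ratOf]
  push_cast
  rw [div_lt_iff₀ this, sub_lt_iff_lt_add]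

/-- The items are distinct elements of `levels` for the set `J` of their boxes, which are disjoint
and lie in the open set, so `card_levels_le` bounds their number. -/
theorem ratOf_lt_of_certifies [IsProbabilityMeasure P] (hX : ∀ i, Measurable (X i))
    (hν : IsDirectingRandomMeasure P X ν)
    (hχ : HasLaw (fun ω i => X i ω) (χ : Measure (ℕ → ℝ)) P)
    (hμ : HasLaw ν (μ : Measure (ProbabilityMeasure ℝ)) P)
    {L : List (List (List (RatCode × RatCode)))} {q : RatCode} {k : Certificate}
    (hk : Certifies (L, q) k)
    (hB : ∀ x ∈ k.2, Encodable.encode (itemName k.1.2.1 x) ∈ measureLawRep μ) :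
    (ratOf q : ℝ) < (χ : Measure (ℕ → ℝ)).real (latticeSet ratCylinder L) := by
  classical
  obtain ⟨⟨C, D, N⟩, W⟩ := k
  obtain ⟨hC, hW, hitems, hcard⟩ := hk
  simp only at hC hW hitems hcard hB
  have hK : (0 : ℝ) < (D + 1 : ℕ) := by positivity
  set T := W.toFinset.image (Item.toWord N) with hT
  set J := T.image fun y => y.1.1 with hJ
  have hTcard : T.card = W.length := by
    rw [hT, Finset.card_image_of_injOn, List.toFinset_card_of_nodup hW]
    intro x hx y hy hxy
    rw [← Item.ofWord_toWord (hitems x (by simpa using hx)).1, hxy,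
      Item.ofWord_toWord (hitems y (by simpa using hy)).1]
  have hcell : ∀ x ∈ W, ∀ i, (x.toWord N).1.1 i ∈ C ∧ 0 < (x.toWord N).1.2 i := fun x hx =>
    (Item.forall_mem_iff (hitems x hx).1).1 (hitems x hx).2.2.1
  have hJdisj : ∀ j ∈ J, ∀ k ∈ J, j ≠ k →
      ∃ i, Disjoint (ratInterval (j i)) (ratInterval (k i)) := by
    intro j hj k hk hjk
    simp only [hJ, hT, Finset.mem_image, List.mem_toFinset, exists_exists_and_eq_and] at hj hk
    obtain ⟨x, hx, rfl⟩ := hj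
    obtain ⟨y, hy, rfl⟩ := hk
    obtain ⟨i, hi⟩ := Function.ne_iff.1 hjk
    exact ⟨i, ((hC _ (hcell x hx i).1 _ (hcell y hy i).1).resolve_left hi).disjoint⟩
  have hTsub : T ⊆ levels P ν ratInterval (D + 1) J := by
    intro y hy
    have hyJ : y.1.1 ∈ J := Finset.mem_image_of_mem _ hy
    obtain ⟨x, hx, rfl⟩ := Finset.mem_image.1 hy
    have hx : x ∈ W := by simpa using hx
    have hlt := (encode_itemName_mem_iff hμ (hitems x hx).1).1 (hB x hx)
    simp only [levels, Finset.mem_filter, Finset.mem_product, Fintype.mem_piFinset,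
      Finset.mem_Icc]
    have hone : ∀ r : ℝ, r ≤ 1 → ∀ n : ℕ, (n : ℝ) < (D + 1 : ℕ) * r → n ≤ D + 1 := by
      intro r hr n hn
      have := hn.trans_le (mul_le_of_le_one_right hK.le hr)
      exact_mod_cast this.le
    refine ⟨⟨⟨hyJ, fun i => ⟨(hcell x hx i).2, ?_⟩⟩, (hitems x hx).2.1,
      hone _ measureReal_le_one _ hlt⟩, hlt⟩
    -- A side level above `D + 1` would make the event empty, and its probability could not exceed a
    -- level.
    by_contra! hi
    have hempty : {ω | ∀ i, ((x.toWord N).1.2 i : ℝ) <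
        (D + 1 : ℕ) * (ν ω : Measure ℝ).real (ratInterval ((x.toWord N).1.1 i))} = ∅ :=
      Set.eq_empty_iff_forall_notMem.2 fun ω hω =>
        hi.not_ge (hone _ measureReal_le_one _ (hω i))
    rw [hempty, measureReal_empty, mul_zero] at hlt
    exact (Nat.cast_nonneg _).not_gt hlt
  have hsub : (⋃ j ∈ J, box ratInterval j) ⊆ latticeSet ratCylinder L := by
    refine Set.iUnion₂_subset fun j hj => ?_
    simp only [hJ, hT, Finset.mem_image, List.mem_toFinset, exists_exists_and_eq_and] at hj
    obtain ⟨x, hx, rfl⟩ := hj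
    obtain ⟨hlen, -, -, l, hl, hfit⟩ := hitems x hx
    exact fun z hz => ⟨l, hl, fun τ hτ => ((fits_iff hlen).1 (hfit τ hτ)).box_subset hz⟩
  have hle := hν.card_levels_le (K := D + 1) hX measurableSet_ratInterval hJdisj
  have hmono : P.real ((fun ω i => X i ω) ⁻¹' ⋃ j ∈ J, box ratInterval j) ≤
      (χ : Measure (ℕ → ℝ)).real (latticeSet ratCylinder L) :=
    (measureReal_mono (Set.preimage_mono hsub)).trans_eq
      (hχ.measureReal_eq (measurableSet_latticeSet measurableSet_ratCylinder L))
  have hlen : (W.length : ℝ) ≤ (D + 1 : ℕ) ^ (N + 1) *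
      (χ : Measure (ℕ → ℝ)).real (latticeSet ratCylinder L) := by
    rw [← hTcard]
    exact ((Nat.cast_le.2 (Finset.card_le_card hTsub)).trans hle).trans
      (mul_le_mul_of_nonneg_left hmono (by positivity))
  rw [ratOf_lt_iff]
  have hcard' : (q.1 : ℝ) * (D + 1 : ℕ) ^ (N + 1) <
      W.length * (q.2.2 + 1) + q.2.1 * (D + 1 : ℕ) ^ (N + 1) := by exact_mod_cast hcard
  have hpow : (0 : ℝ) < (D + 1 : ℕ) ^ (N + 1) := by positivity
  have h3 := mul_le_mul_of_nonneg_right hlen (by positivity : (0 : ℝ) ≤ q.2.2 + 1)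
  refine lt_of_mul_lt_mul_right (a := ((D + 1 : ℕ) : ℝ) ^ (N + 1)) ?_ hpow.le
  linarith

/-- An open set is approximated by finitely many of the boxes over a family of disjoint
intervals. -/
theorem exists_boxes (χ : ProbabilityMeasure (ℕ → ℝ))
    (L : List (List (List (RatCode × RatCode)))) {ε : ℝ} (hε : 0 < ε) :
    ∃ (N : ℕ) (C : Finset (RatCode × RatCode)) (J : Finset (Fin N → RatCode × RatCode)),
      (∀ a ∈ C, ∀ b ∈ C, a = b ∨ Separated a b) ∧
      (∀ j ∈ J, (∀ i, j i ∈ C) ∧ ∃ l ∈ L, ∀ τ ∈ l, FitsWord τ j) ∧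
      (χ : Measure (ℕ → ℝ)).real (latticeSet ratCylinder L) ≤
        (χ : Measure (ℕ → ℝ)).real (⋃ j ∈ J, box ratInterval j) + ε := by
  classical
  obtain ⟨code, hcode⟩ : ∃ code : ℚ → RatCode, ∀ r, ratOf (code r) = r :=
    ⟨_, fun r => (exists_ratOf_eq r).choose_spec⟩
  obtain ⟨N, hlen⟩ : ∃ N, ∀ l ∈ L, ∀ τ ∈ l, τ.length ≤ N :=
    ⟨L.flatten.toFinset.sup List.length, fun l hl τ hτ => Finset.le_sup (f := List.length)
      (List.mem_toFinset.2 (List.mem_flatten.2 ⟨l, hl, hτ⟩))⟩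
  obtain ⟨E, hmemE⟩ : ∃ E : Finset ℚ, ∀ l ∈ L, ∀ τ ∈ l, ∀ a ∈ τ,
      ratOf a.1 ∈ E ∧ ratOf a.2 ∈ E := by
    refine ⟨(L.flatten.flatten.flatMap fun a => [ratOf a.1, ratOf a.2]).toFinset,
      fun l hl τ hτ a ha => ?_⟩
    have : a ∈ L.flatten.flatten :=
      List.mem_flatten.2 ⟨τ, List.mem_flatten.2 ⟨l, hl, hτ⟩, ha⟩
    simp only [List.mem_toFinset, List.mem_flatMap]
    exact ⟨⟨a, this, by simp⟩, a, this, by simp⟩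
  -- With the sum of the first `N` marginals, `ρ Z` bounds the probability that any of these
  -- coordinates falls into `Z`.
  let ρ : Measure ℝ := ∑ i ∈ Finset.range N, (χ : Measure (ℕ → ℝ)).map fun x => x i
  obtain ⟨C, hC, Z, hZ, hcover⟩ := exists_cells ρ E hε
  let c : ℚ × ℚ → RatCode × RatCode := fun I => (code I.1, code I.2)
  let J : Finset (Fin N → RatCode × RatCode) :=
    (Fintype.piFinset fun _ => C.image c).filter fun j => ∃ l ∈ L, ∀ τ ∈ l, FitsWord τ j
  refine ⟨N, C.image c, J, ?_, ?_, ?_⟩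
  · intro a ha b hb
    obtain ⟨I, hI, rfl⟩ := Finset.mem_image.1 ha
    obtain ⟨I', hI', rfl⟩ := Finset.mem_image.1 hb
    by_cases h : I = I'
    · exact .inl (h ▸ rfl)
    · have := hC I hI I' hI' h
      simp only [Separated, ratLE_iff, c, hcode]
      simp only [min_le_iff, le_max_iff] at this
      tauto
  · intro j hj
    simpa [J] using hj
  · have hsub : latticeSet ratCylinder L ⊆ (⋃ j ∈ J, box ratInterval j) ∪
        ⋃ i ∈ Finset.range N, (fun x : ℕ → ℝ => x i) ⁻¹' Z := by
      rintro x ⟨l, hl, hx⟩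
      by_cases hxZ : ∃ i < N, x i ∈ Z
      · obtain ⟨i, hi, hxi⟩ := hxZ
        exact .inr (Set.mem_biUnion (Finset.mem_coe.2 (Finset.mem_range.2 hi)) hxi)
      · push Not at hxZ
        choose! I hI using fun i (hi : i < N) => hcover (x i) (hxZ i hi)
        refine .inl (Set.mem_biUnion (x := fun i : Fin N => c (I i)) ?_ ?_)
        · simp only [J, Finset.coe_filter, Fintype.mem_piFinset, Set.mem_ofPred_eq]
          refine ⟨fun i => Finset.mem_image_of_mem _ (hI i i.2).1, l, hl, fun τ hτ i hi => ?_⟩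
          have hiN := hi.trans_le (hlen l hl τ hτ)
          obtain ⟨hE1, hE2⟩ := hmemE l hl τ hτ τ[i] (List.getElem_mem hi)
          obtain ⟨hx1, hx2⟩ := hx τ hτ i hi
          obtain ⟨-, -, -, h⟩ := hI i hiN
          -- `x i` lies strictly between the endpoints of `τ[i]`; these belong to `E`, so the cell
          -- of `x i` lies between them too.
          refine ⟨hiN, ?_, ?_⟩
          · simpa [c, hcode] using (h _ hE1).2 hx1
          · simpa [c, hcode] using (h _ hE2).1 hx2
        · intro i
          simpa [ratInterval, c, hcode] using ⟨(hI i i.2).2.1, (hI i i.2).2.2.1⟩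
    have hbad : (χ : Measure (ℕ → ℝ)) (⋃ i ∈ Finset.range N, (fun x : ℕ → ℝ => x i) ⁻¹' Z) ≤
        ρ Z := by
      refine (measure_biUnion_finset_le _ _).trans ?_
      rw [Measure.finsetSum_apply]
      exact Finset.sum_le_sum fun i _ =>
        Measure.le_map_apply (μ := (χ : Measure (ℕ → ℝ))) (f := fun x : ℕ → ℝ => x i)
          (measurable_pi_apply i).aemeasurable Z
    refine (measureReal_mono hsub).trans ((measureReal_union_le _ _).trans ?_)
    exact add_le_add_right ((ENNReal.toReal_mono (measure_ne_top _ _) hbad).trans hZ) _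

/-- The certificate lists all of `levels` for a good family of boxes and a large `D`. -/
theorem exists_certifies [IsProbabilityMeasure P] (hX : ∀ i, Measurable (X i))
    (hν : IsDirectingRandomMeasure P X ν)
    (hχ : HasLaw (fun ω i => X i ω) (χ : Measure (ℕ → ℝ)) P)
    (hμ : HasLaw ν (μ : Measure (ProbabilityMeasure ℝ)) P)
    {L : List (List (List (RatCode × RatCode)))} {q : RatCode}
    (hq : (ratOf q : ℝ) < (χ : Measure (ℕ → ℝ)).real (latticeSet ratCylinder L)) :
    ∃ k : Certificate, Certifies (L, q) k ∧
      ∀ x ∈ k.2, Encodable.encode (itemName k.1.2.1 x) ∈ measureLawRep μ := by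
  classical
  set u := (χ : Measure (ℕ → ℝ)).real (latticeSet ratCylinder L) with hu
  -- Half of the gap pays for the approximation by boxes, the other half for the rounding error
  -- `J.card * (N + 1) / (D + 1)`.
  have hε : 0 < (u - ratOf q) / 2 := by linarith
  obtain ⟨N, C, J, hC, hJ, hle⟩ := exists_boxes χ L hε
  obtain ⟨D, hD⟩ := exists_nat_gt ((J.card * (N + 1) : ℝ) / ((u - ratOf q) / 2))
  rw [div_lt_iff₀ hε] at hD
  have hK : (0 : ℝ) < (D + 1 : ℕ) := by positivity
  have hJdisj : ∀ j ∈ J, ∀ k ∈ J, j ≠ k →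
      ∃ i, Disjoint (ratInterval (j i)) (ratInterval (k i)) := by
    intro j hj k hk hjk
    obtain ⟨i, hi⟩ := Function.ne_iff.1 hjk
    exact ⟨i, ((hC _ ((hJ j hj).1 i) _ ((hJ k hk).1 i)).resolve_left hi).disjoint⟩
  have hcard := hν.le_card_levels (K := D + 1) hX measurableSet_ratInterval hJdisj (Nat.succ_pos D)
  have hBm : MeasurableSet (⋃ j ∈ J, box ratInterval j) :=
    Finset.measurableSet_biUnion _ fun j _ => measurableSet_box measurableSet_ratInterval j
  have hlaw : P.real ((fun ω i => X i ω) ⁻¹' ⋃ j ∈ J, box ratInterval j) =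
      (χ : Measure (ℕ → ℝ)).real (⋃ j ∈ J, box ratInterval j) := hχ.measureReal_eq hBm
  rw [hlaw] at hcard
  set T := levels P ν ratInterval (D + 1) J with hT
  have hlen : ∀ y : ((Fin N → RatCode × RatCode) × (Fin N → ℕ)) × ℕ,
      (Item.ofWord y).2.length = N := fun y => by simp [Item.ofWord]
  have hitem : ∀ x ∈ T.toList.map Item.ofWord, ∃ y ∈ T, x = Item.ofWord y := by
    intro x hx
    obtain ⟨y, hy, rfl⟩ := List.mem_map.1 hx
    exact ⟨y, Finset.mem_toList.1 hy, rfl⟩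
  refine ⟨((C.toList, D, N), T.toList.map Item.ofWord), ⟨?_, ?_, ?_, ?_⟩, ?_⟩
  · simpa using hC
  · exact T.nodup_toList.map (Function.LeftInverse.injective Item.toWord_ofWord)
  · intro x hx
    obtain ⟨y, hy, rfl⟩ := hitem x hx
    simp only [hT, levels, Finset.mem_filter, Finset.mem_product, Fintype.mem_piFinset,
      Finset.mem_Icc] at hy
    obtain ⟨⟨⟨hyJ, hyn⟩, hyt⟩, -⟩ := hy
    refine ⟨hlen y, hyt.1, ?_, ?_⟩
    · rw [Item.forall_mem_iff (hlen y), Item.toWord_ofWord]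
      exact fun i => ⟨by simpa using (hJ _ hyJ).1 i, (hyn i).1⟩
    · obtain ⟨l, hl, hfit⟩ := (hJ _ hyJ).2
      refine ⟨l, hl, fun τ hτ => (fits_iff (hlen y)).2 ?_⟩
      have : (fun i : Fin N => ((Item.ofWord y).2.getD i 0).1) = y.1.1 :=
        congrArg (fun z => z.1.1) (Item.toWord_ofWord y)
      rw [this]
      exact hfit τ hτ
  · have hpow : (0 : ℝ) < (D + 1 : ℕ) ^ N := by positivity
    have key : (ratOf q : ℝ) < T.card / (D + 1 : ℕ) ^ (N + 1) := by
      rw [lt_div_iff₀ (by positivity), pow_succ]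
      rw [pow_succ] at hcard
      have h1 := mul_le_mul_of_nonneg_left hle (mul_pos hpow hK).le
      have h2 : (J.card * (N + 1) : ℝ) < (u - ratOf q) / 2 * (D + 1 : ℕ) := by
        push_cast
        linarith
      have h3 := mul_lt_mul_of_pos_left h2 hpow
      nlinarith
    rw [ratOf_lt_iff, div_mul_eq_mul_div, ← sub_lt_iff_lt_add, lt_div_iff₀ (by positivity),
      sub_mul, sub_lt_iff_lt_add] at key
    simp only [List.length_map, Finset.length_toList]
    exact_mod_cast key
  · intro x hx
    obtain ⟨y, hy, rfl⟩ := hitem x hx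
    rw [encode_itemName_mem_iff hμ (hlen y), Item.toWord_ofWord]
    exact (Finset.mem_filter.1 hy).2

end Law

end ComputableDeFinetti

/-- There is one program that, whenever `X` is an exchangeable sequence with distribution `χ` and
`μ` is the distribution of its directing random measure `ν`, computes `χ` from `μ`. -/
theorem proposition5p1 :
    ∃ c : ComputableDeFinetti.OracleCode,
      ∀ (Ω : Type*) [MeasurableSpace Ω] (P : Measure Ω) [IsProbabilityMeasure P]
        (X : ℕ → Ω → ℝ) (ν : Ω → ProbabilityMeasure ℝ)
        (χ : ProbabilityMeasure (ℕ → ℝ)) (μ : ProbabilityMeasure (ProbabilityMeasure ℝ)),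
        (∀ i, Measurable (X i)) →
        ComputableDeFinetti.Exchangeable P X →
        ComputableDeFinetti.IsDirectingRandomMeasure P X ν →
        HasLaw (fun ω i => X i ω) (χ : Measure (ℕ → ℝ)) P →
        HasLaw ν (μ : Measure (ProbabilityMeasure ℝ)) P →
        c.ComputesFrom (ComputableDeFinetti.seqLawRep χ) (ComputableDeFinetti.measureLawRep μ) := by
  obtain ⟨c, hc⟩ := ComputableDeFinetti.exists_computesFrom_of_certifies
  refine ⟨c, fun Ω _ P _ X ν χ μ hX _ hν hχ hμ => hc _ _ fun n => ?_⟩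
  constructor
  · rintro ⟨i, hi, hq⟩
    exact ⟨i, hi, ComputableDeFinetti.exists_certifies hX hν hχ hμ hq⟩
  · rintro ⟨i, hi, k, hk, hB⟩
    exact ⟨i, hi, ComputableDeFinetti.ratOf_lt_of_certifies hX hν hχ hμ hk hB⟩
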